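/- **Proposition (Gateaux derivative of $\hat\Psi$).** For $X\in\mathbb{R}^{n_1\times n_2}$ let $m=\min(n_1,n_2)$ and let $\sigma_1(X)\ge\dots\ge\sigma_m(X)\ge 0$ be the singular values of $X$. For $d_1,\dots,d_m\in\mathbb{R}$ let $\mathrm{Diag}(d_1,\dots,d_m)_{n_1\times n_2}$ be the $n_1\times n_2$ matrix with diagonal entries $d_1,\dots,d_m$ and all other entries $0$. For $\varphi:\mathbb{R}\to\mathbb{R}$ and $\alpha\in\mathbb{R}$ put $$\psi(t)=\varphi(t)-\alpha|t|,\qquad \hat\Psi(X)=\sum_{i=1}^{m}\psi(\sigma_i(X)).$$ (a) Suppose that $\varphi$ is even and $\psi$ is $C^1$ on $\mathbb{R}$. Then $\hat\Psi$ is Gateaux differentiable at every $X\in\mathbb{R}^{n_1\times n_2}$, and, identifying the derivative with the matrix representing it in the Frobenius inner product $\langle G,H\rangle=\mathrm{tr}(G^{*}H)$, $$D_X\hat\Psi(X)=U^{*}\Lambda V,\qquad \Lambda=\mathrm{Diag}\big(\psi'(\sigma_1(X)),\dots,\psi'(\sigma_m(X))\big)_{n_1\times n_2},$$ for every singular value decomposition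 $X=U^{*}\Sigma V$ with $U\in\mathbb{R}^{n_1\times n_1}$, $V\in\mathbb{R}^{n_2\times n_2}$ orthogonal and $\Sigma=\mathrm{Diag}(\sigma_1(X),\dots,\sigma_m(X))_{n_1\times n_2}$ (so the rows of $U$ and $V$ are left and right singular vectors of $X$). That is, $\lim_{t\to0}\frac{\hat\Psi(X+tH)-\hat\Psi(X)}{t}=\langle U^{*}\Lambda V,H\rangle$ for every $H\in\mathbb{R}^{n_1\times n_2}$. (b) In particular, for $\alpha>0$ and $\varphi(t)=\frac{\alpha|t|}{1+\alpha|t|}$, the function $\psi$ is $C^2$ on $\mathbb{R}$, $\hat\Psi$ is Gateaux differentiable at every $X\in\mathbb{R}^{n_1\times n_2}$, and the same formula $D_X\hat\Psi(X)=U^{*}\Lambda V$ holds for every such singular value decomposition. -/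

import Mathlib

/-- The `i`-th largest singular value (counted from `0`) of the real matrix `X`. -/
noncomputable def sigma {m n : ℕ} (X : Matrix (Fin m) (Fin n) ℝ) (i : ℕ) : ℝ :=
  (Matrix.toEuclideanLin X).singularValues i

/-- The `m × n` rectangular diagonal matrix with diagonal entries `d 0, d 1, …`. -/
def rectDiag (m n : ℕ) (d : ℕ → ℝ) : Matrix (Fin m) (Fin n) ℝ :=
  Matrix.of fun i j => if (i : ℕ) = (j : ℕ) then d i else 0

/-- `X = Uᵀ Σ V` is a (full) singular value decomposition of `X`: the rows of the orthogonal
matrices `U` and `V` are left and right singular vectors of `X`, in the order of the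
decreasing singular values. -/
structure IsSVD {m n : ℕ} (X : Matrix (Fin m) (Fin n) ℝ)
    (U : Matrix (Fin m) (Fin m) ℝ) (V : Matrix (Fin n) (Fin n) ℝ) : Prop where
  left_orthogonal : U ∈ Matrix.orthogonalGroup (Fin m) ℝ
  right_orthogonal : V ∈ Matrix.orthogonalGroup (Fin n) ℝ
  eq_mul : X = U.transpose * rectDiag m n (sigma X) * V

/-- The penalty `φ(t) = α|t| / (1 + α|t|)`. -/
noncomputable def fracPenalty (α t : ℝ) : ℝ := α * |t| / (1 + α * |t|)

/-- `ψ(t) = φ(t) - α|t|`. -/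
def psi (φ : ℝ → ℝ) (α t : ℝ) : ℝ := φ t - α * |t|

/-- `Φ̂(X) = ∑ φ(σ_i(X))`, the sum over the `min m n` singular values of `X`. -/
noncomputable def PhiHat {m n : ℕ} (φ : ℝ → ℝ) (X : Matrix (Fin m) (Fin n) ℝ) : ℝ :=
  ∑ i ∈ Finset.range (min m n), φ (sigma X i)

/-- The nuclear norm `‖X‖_*`. -/
noncomputable def nuclearNorm {m n : ℕ} (X : Matrix (Fin m) (Fin n) ℝ) : ℝ :=
  ∑ i ∈ Finset.range (min m n), sigma X i

/-- `Ψ̂(X) = ∑ ψ(σ_i(X))`, the sum over the `min m n` singular values of `X`. -/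
noncomputable def PsiHat {m n : ℕ} (φ : ℝ → ℝ) (α : ℝ) (X : Matrix (Fin m) (Fin n) ℝ) : ℝ :=
  ∑ i ∈ Finset.range (min m n), psi φ α (sigma X i)

/-- `Ψ̂(X) = Φ̂(X) - α‖X‖_*`. -/
theorem PsiHat_eq {m n : ℕ} (φ : ℝ → ℝ) (α : ℝ) (X : Matrix (Fin m) (Fin n) ℝ) :
    PsiHat φ α X = PhiHat φ X - α * nuclearNorm X := by
  have h : ∀ i, |sigma X i| = sigma X i := fun i =>
    abs_of_nonneg ((Matrix.toEuclideanLin X).singularValues_nonneg i)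
  simp [PsiHat, PhiHat, nuclearNorm, psi, h, Finset.sum_sub_distrib, Finset.mul_sum]

/-- `F` is Gateaux differentiable at `X` and its Gateaux derivative is the linear functional
`H ↦ ⟨G, H⟩ = tr(Gᵀ H)`, that is, it is represented by the matrix `G` in the Frobenius inner
product. -/
def HasGateauxDerivAt {m n : ℕ} (F : Matrix (Fin m) (Fin n) ℝ → ℝ)
    (G X : Matrix (Fin m) (Fin n) ℝ) : Prop :=
  ∀ H : Matrix (Fin m) (Fin n) ℝ,
    HasLineDerivAt ℝ F (Matrix.trace (G.transpose * H)) X H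

/-!
For `k ≥ 1` the even power sum `∑ σ_i(X)^(2k)` is `tr((XᵀX)^k)`, so by cyclicity of the trace its
Gateaux derivative is `2k X(XᵀX)^(k-1)`, which in any singular value decomposition `X = Uᵀ Σ V`
equals `Uᵀ Diag(2k σ_i^(2k-1)) V`. By linearity the formula holds for all even polynomials. The
entries of orthogonal matrices are at most one in absolute value, so the pairing of `Uᵀ Diag(d_i) V`
with `H` is controlled by `max |d_i|` whichever decomposition is chosen, and the formula therefore
survives limits in which the derivatives converge uniformly on compact intervals. Since `ψ'` is odd,
Weierstrass approximation of `ψ'` reaches every even `C¹` function `ψ`. The fractional penalty is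
`F(|t|) + α|t|` with `F'(0) = 0`, and this is what makes `ψ(t) = F(|t|)` twice continuously
differentiable across `0`.
-/

section SingularValueDecomposition

open Module
open scoped Matrix

variable {𝕜 E F : Type*} [RCLike 𝕜] [NormedAddCommGroup E] [InnerProductSpace 𝕜 E]
  [FiniteDimensional 𝕜 E] [NormedAddCommGroup F] [InnerProductSpace 𝕜 F] [FiniteDimensional 𝕜 F]

theorem exists_orthonormalBasis_inner_map_map_eq (T : E →ₗ[𝕜] F) {n : ℕ} (hn : finrank 𝕜 E = n) :
    ∃ v : OrthonormalBasis (Fin n) 𝕜 E, ∀ i j,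
      inner 𝕜 (T (v i)) (T (v j)) = if i = j then (T.singularValues j : 𝕜) ^ 2 else 0 := by
  refine ⟨T.isSymmetric_adjoint_comp_self.eigenvectorBasis hn, fun i j => ?_⟩
  have h_eigen := T.isSymmetric_adjoint_comp_self.apply_eigenvectorBasis hn j
  rw [LinearMap.comp_apply, ← T.sq_singularValues_fin hn j] at h_eigen
  rw [← LinearMap.adjoint_inner_right, h_eigen, inner_smul_right, OrthonormalBasis.inner_eq_ite]
  simp

theorem exists_orthonormalBasis_inner_map_eq (T : E →ₗ[𝕜] F) {m n : ℕ} (hm : finrank 𝕜 F = m)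
    (hn : finrank 𝕜 E = n) :
    ∃ (u : OrthonormalBasis (Fin m) 𝕜 F) (v : OrthonormalBasis (Fin n) 𝕜 E), ∀ i j,
      inner 𝕜 (u i) (T (v j)) = if (i : ℕ) = j then (T.singularValues i : 𝕜) else 0 := by
  obtain ⟨v, hv⟩ := exists_orthonormalBasis_inner_map_map_eq T hn
  let w : Fin m → F := fun i =>
    if h : (i : ℕ) < n then (T.singularValues i : 𝕜)⁻¹ • T (v ⟨i, h⟩) else 0
  let s : Set (Fin m) := {i | (i : ℕ) < n ∧ T.singularValues i ≠ 0}
  have w_apply (i : Fin m) (hi : (i : ℕ) < n) :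
      w i = (T.singularValues i : 𝕜)⁻¹ • T (v ⟨i, hi⟩) := dif_pos hi
  have w_orthonormal : Orthonormal 𝕜 (s.domRestrict w) := by
    rw [orthonormal_iff_ite]
    rintro ⟨i, hi, hi₀⟩ ⟨j, hj, hj₀⟩
    simp only [Set.domRestrict_apply, w_apply i hi, w_apply j hj, inner_smul_left,
      inner_smul_right, hv, Subtype.mk.injEq, Fin.ext_iff]
    split_ifs with hij
    · simp [hij, hj₀, sq]
    · simp
  obtain ⟨u, hu⟩ := w_orthonormal.exists_orthonormalBasis_extension_of_card_eq (by simpa using hm)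
  refine ⟨u, v, fun i j => ?_⟩
  by_cases hj : T.singularValues j = 0
  · have map_eq_zero : T (v j) = 0 := by simpa [hj] using hv j j
    rw [map_eq_zero, inner_zero_right]
    split_ifs with hij <;> simp [hij, hj]
  · have hjm : (j : ℕ) < m := by
      have j_lt_rank := T.singularValues_pos_iff_lt_finrank_range.mp
        ((T.singularValues_pos_iff_ne_zero j).mpr hj)
      exact j_lt_rank.trans_le (hm ▸ Submodule.finrank_le _)
    have map_eq : T (v j) = (T.singularValues j : 𝕜) • u ⟨j, hjm⟩ := by
      rw [hu ⟨j, hjm⟩ ⟨j.2, hj⟩, w_apply ⟨j, hjm⟩ j.2, smul_inv_smul₀ (by simpa using hj)]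
    rw [map_eq, inner_smul_right, u.inner_eq_ite]
    simp only [Fin.ext_iff]
    split_ifs with hij <;> simp [hij]

theorem orthonormalBasis_rows_mem_unitaryGroup {ι : Type*} [Fintype ι] [DecidableEq ι]
    (b : OrthonormalBasis ι 𝕜 (EuclideanSpace 𝕜 ι)) :
    Matrix.of (fun i k => b i k) ∈ Matrix.unitaryGroup ι 𝕜 := by
  rw [Matrix.mem_unitaryGroup_iff]
  ext i j
  simpa [Matrix.mul_apply, Matrix.one_apply, PiLp.inner_apply, eq_comm] using b.inner_eq_ite j i

theorem exists_isSVD {m n : ℕ} (X : Matrix (Fin m) (Fin n) ℝ) : ∃ U V, IsSVD X U V := by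
  obtain ⟨u, v, huv⟩ := exists_orthonormalBasis_inner_map_eq (Matrix.toEuclideanLin X)
    finrank_euclideanSpace_fin finrank_euclideanSpace_fin
  have hU := orthonormalBasis_rows_mem_unitaryGroup u
  have hV := orthonormalBasis_rows_mem_unitaryGroup v
  set U := Matrix.of fun i k => u i k with U_def
  set V := Matrix.of fun j k => v j k with V_def
  have conj_eq : U * (X * Vᵀ) = rectDiag m n (sigma X) := by
    ext i j
    refine Eq.trans ?_ (huv i j)
    simp [U_def, V_def, Matrix.mul_apply, Matrix.mulVec, dotProduct, PiLp.inner_apply,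
      Matrix.toLpLin_apply, mul_comm]
  refine ⟨U, V, hU, hV, ?_⟩
  have hU' : Uᵀ * U = 1 := (Matrix.mem_orthogonalGroup_iff' _ _).mp hU
  have hV' : Vᵀ * V = 1 := (Matrix.mem_orthogonalGroup_iff' _ _).mp hV
  rw [← conj_eq, ← Matrix.mul_assoc, hU', Matrix.one_mul, Matrix.mul_assoc, hV', Matrix.mul_one]

end SingularValueDecomposition

section TracialDerivative

variable {𝕜 A E : Type*} [NontriviallyNormedField 𝕜] [NormedRing A] [NormedAlgebra 𝕜 A]
  [NormedAddCommGroup E] [NormedSpace 𝕜 E]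

theorem hasDerivAt_tracial_pow (τ : A →L[𝕜] E) (hτ : ∀ a b, τ (a * b) = τ (b * a)) {a : 𝕜 → A}
    {a' : A} {t : 𝕜} (ha : HasDerivAt a a' t) (k : ℕ) :
    HasDerivAt (fun s => τ (a s ^ k)) (k • τ (a t ^ (k - 1) * a')) t := by
  refine (τ.hasFDerivAt.comp_hasDerivAt t (ha.fun_pow' k)).congr_deriv ?_
  have cycle (i : ℕ) (hi : i ∈ Finset.range k) :
      τ (a t ^ (k.pred - i) * a' * a t ^ i) = τ (a t ^ (k - 1) * a') := by
    have hik : i + (k.pred - i) = k - 1 := by grind [Nat.pred_eq_sub_one]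
    rw [hτ, ← mul_assoc, ← pow_add, hik]
  rw [map_sum, Finset.sum_congr rfl cycle, Finset.sum_const, Finset.card_range]

end TracialDerivative

section GramMatrix

open scoped Matrix

variable {m n : ℕ}

theorem sigma_eq_zero_of_min_le (X : Matrix (Fin m) (Fin n) ℝ) {i : ℕ} (hi : min m n ≤ i) :
    sigma X i = 0 := by
  set T := Matrix.toEuclideanLin X
  have rank_le_left : Module.finrank ℝ (LinearMap.range T) ≤ m := by
    simpa using Submodule.finrank_le (LinearMap.range T)
  have rank_le_right : Module.finrank ℝ (LinearMap.range T) ≤ n := by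
    simpa using LinearMap.finrank_range_le T
  exact T.singularValues_eq_zero_iff_le_finrank_range.mpr (by omega)

theorem rectDiag_mul_diagonal (d e : ℕ → ℝ) :
    rectDiag m n d * Matrix.diagonal (fun j : Fin n => e j) =
      rectDiag m n (fun i => d i * e i) := by
  ext i j
  by_cases hij : (i : ℕ) = j <;> simp [rectDiag, hij]

theorem transpose_rectDiag_mul_rectDiag {d : ℕ → ℝ} (hd : ∀ i, m ≤ i → d i = 0) :
    (rectDiag m n d)ᵀ * rectDiag m n d = Matrix.diagonal fun j : Fin n => d j ^ 2 := by
  ext i j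
  simp only [Matrix.mul_apply, Matrix.transpose_apply, rectDiag, Matrix.of_apply,
    Matrix.diagonal_apply]
  by_cases him : (i : ℕ) < m
  · rw [Finset.sum_eq_single_of_mem ⟨i, him⟩ (Finset.mem_univ _)
      fun k _ hk => by simp [show (k : ℕ) ≠ i from fun h => hk (Fin.ext h)]]
    simp [Fin.ext_iff, sq]
  · rw [Finset.sum_eq_zero fun k _ => by simp [show (k : ℕ) ≠ i by omega]]
    simp [hd i (by omega)]

namespace IsSVD

variable {X : Matrix (Fin m) (Fin n) ℝ} {U : Matrix (Fin m) (Fin m) ℝ}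
  {V : Matrix (Fin n) (Fin n) ℝ}

theorem left_mul_transpose (h : IsSVD X U V) : U * Uᵀ = 1 :=
  (Matrix.mem_orthogonalGroup_iff _ _).mp h.left_orthogonal

theorem right_mul_transpose (h : IsSVD X U V) : V * Vᵀ = 1 :=
  (Matrix.mem_orthogonalGroup_iff _ _).mp h.right_orthogonal

theorem right_transpose_mul (h : IsSVD X U V) : Vᵀ * V = 1 :=
  (Matrix.mem_orthogonalGroup_iff' _ _).mp h.right_orthogonal

theorem semiconjBy_gram (h : IsSVD X U V) :
    SemiconjBy V (Xᵀ * X) (Matrix.diagonal fun j : Fin n => sigma X j ^ 2) := by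
  have hd (i : ℕ) (hi : m ≤ i) : sigma X i = 0 := sigma_eq_zero_of_min_le X (by omega)
  rw [SemiconjBy, ← transpose_rectDiag_mul_rectDiag hd]
  set D := rectDiag m n (sigma X)
  calc V * (Xᵀ * X) = V * ((Uᵀ * D * V)ᵀ * (Uᵀ * D * V)) := by rw [← h.eq_mul]
    _ = (V * Vᵀ) * Dᵀ * (U * Uᵀ) * D * V := by
      simp only [Matrix.transpose_mul, Matrix.transpose_transpose, Matrix.mul_assoc]
    _ = Dᵀ * D * V := by
      rw [h.left_mul_transpose, h.right_mul_transpose, Matrix.one_mul, Matrix.mul_one]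

theorem gram_pow (h : IsSVD X U V) (k : ℕ) :
    (Xᵀ * X) ^ k = Vᵀ * Matrix.diagonal (fun j : Fin n => sigma X j ^ (2 * k)) * V := by
  have h_pow := (h.semiconjBy_gram.pow_right k).eq
  rw [Matrix.diagonal_pow] at h_pow
  simp only [pow_mul]
  rw [Matrix.mul_assoc, ← Pi.pow_def, ← h_pow, ← Matrix.mul_assoc, h.right_transpose_mul,
    Matrix.one_mul]

theorem mul_gram_pow (h : IsSVD X U V) (k : ℕ) :
    X * (Xᵀ * X) ^ k = Uᵀ * rectDiag m n (fun i => sigma X i ^ (2 * k + 1)) * V := by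
  set D := Matrix.diagonal fun j : Fin n => sigma X j ^ (2 * k) with D_def
  have hX : X * Vᵀ = Uᵀ * rectDiag m n (sigma X) := by
    conv_lhs => rw [h.eq_mul, Matrix.mul_assoc, h.right_mul_transpose, Matrix.mul_one]
  have hD : rectDiag m n (sigma X) * D = rectDiag m n fun i => sigma X i ^ (2 * k + 1) := by
    simp only [D_def, rectDiag_mul_diagonal _ fun i => sigma X i ^ (2 * k), pow_succ']
  rw [h.gram_pow, ← Matrix.mul_assoc, ← Matrix.mul_assoc, hX, Matrix.mul_assoc Uᵀ, hD]

end IsSVD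

theorem PhiHat_even_pow (X : Matrix (Fin m) (Fin n) ℝ) {k : ℕ} (hk : k ≠ 0) :
    PhiHat (fun t => t ^ (2 * k)) X = ((Xᵀ * X) ^ k).trace := by
  obtain ⟨U, V, h⟩ := exists_isSVD X
  rw [h.gram_pow, Matrix.trace_mul_cycle, h.right_mul_transpose, Matrix.one_mul,
    Matrix.trace_diagonal, Fin.sum_univ_eq_sum_range fun j => sigma X j ^ (2 * k)]
  refine Finset.sum_subset (by simp) fun i _ hi => ?_
  simp only [Finset.mem_range, not_lt] at hi
  simp [sigma_eq_zero_of_min_le X hi, hk]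

theorem sigma_sq_le_trace_gram (X : Matrix (Fin m) (Fin n) ℝ) (i : ℕ) :
    sigma X i ^ 2 ≤ (Xᵀ * X).trace := by
  have h_sum : ∑ j ∈ Finset.range (min m n), sigma X j ^ 2 = (Xᵀ * X).trace := by
    simpa using! PhiHat_even_pow X one_ne_zero
  rw [← h_sum]
  by_cases hi : i < min m n
  · exact Finset.single_le_sum (fun j _ => sq_nonneg (sigma X j)) (Finset.mem_range.mpr hi)
  · rw [sigma_eq_zero_of_min_le X (by omega), zero_pow two_ne_zero]
    exact Finset.sum_nonneg fun j _ => sq_nonneg _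

end GramMatrix

namespace HasGateauxDerivAt

variable {m n : ℕ} {F F₁ F₂ : Matrix (Fin m) (Fin n) ℝ → ℝ} {G G₁ G₂ X : Matrix (Fin m) (Fin n) ℝ}

theorem const (c : ℝ) (X : Matrix (Fin m) (Fin n) ℝ) : HasGateauxDerivAt (fun _ => c) 0 X :=
  fun H => (hasDerivAt_const (0 : ℝ) c).congr_deriv (by simp)

theorem add (h₁ : HasGateauxDerivAt F₁ G₁ X) (h₂ : HasGateauxDerivAt F₂ G₂ X) :
    HasGateauxDerivAt (fun Y => F₁ Y + F₂ Y) (G₁ + G₂) X :=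
  fun H => (HasDerivAt.fun_add (h₁ H) (h₂ H)).congr_deriv (by simp [Matrix.add_mul])

theorem const_mul (c : ℝ) (h : HasGateauxDerivAt F G X) :
    HasGateauxDerivAt (fun Y => c * F Y) (c • G) X :=
  fun H => (HasDerivAt.const_mul c (h H)).congr_deriv (by simp)

theorem unique (h₁ : HasGateauxDerivAt F G₁ X) (h₂ : HasGateauxDerivAt F G₂ X) : G₁ = G₂ :=
  Matrix.transpose_injective <| Matrix.ext_iff_trace_mul_right.mpr fun H => (h₁ H).unique (h₂ H)

theorem hasDerivAt_line {H : Matrix (Fin m) (Fin n) ℝ} {t : ℝ}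
    (h : HasGateauxDerivAt F G (X + t • H)) :
    HasDerivAt (fun s : ℝ => F (X + s • H)) (G.transpose * H).trace t := by
  have h_line :
      HasDerivAt (fun s : ℝ => F (X + t • H + s • H)) (G.transpose * H).trace (t - t) := by
    simpa using! h H
  refine (h_line.comp_sub_const t t).congr_of_eventuallyEq (.of_forall fun s => ?_)
  simp only [sub_smul, add_add_sub_cancel]

end HasGateauxDerivAt

section PowerTraces

open scoped Matrix

attribute [local instance] Matrix.linftyOpNormedRing Matrix.linftyOpNormedAlgebra

variable {m n : ℕ}

theorem hasDerivAt_trace_pow {𝕜 ι : Type*} [NontriviallyNormedField 𝕜] [CompleteSpace 𝕜]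
    [Fintype ι] [DecidableEq ι] {A : 𝕜 → Matrix ι ι 𝕜} {A' : Matrix ι ι 𝕜} {t : 𝕜}
    (hA : HasDerivAt A A' t) (k : ℕ) :
    HasDerivAt (fun s => (A s ^ k).trace) (k * (A t ^ (k - 1) * A').trace) t := by
  let τ : Matrix ι ι 𝕜 →L[𝕜] 𝕜 := (Matrix.traceLinearMap ι 𝕜 𝕜).toContinuousLinearMap
  exact (hasDerivAt_tracial_pow τ Matrix.trace_mul_comm hA k).congr_deriv (nsmul_eq_mul _ _)

theorem hasDerivAt_gram_line (X H : Matrix (Fin m) (Fin n) ℝ) :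
    HasDerivAt (fun t : ℝ => (X + t • H)ᵀ * (X + t • H)) (Hᵀ * X + Xᵀ * H) 0 := by
  have expand (t : ℝ) : (X + t • H)ᵀ * (X + t • H) =
      Xᵀ * X + t • (Hᵀ * X + Xᵀ * H) + t ^ 2 • (Hᵀ * H) := by
    simp only [Matrix.transpose_add, Matrix.transpose_smul, Matrix.add_mul, Matrix.mul_add,
      Matrix.smul_mul, Matrix.mul_smul]
    module
  simp only [expand]
  refine ((((hasDerivAt_id (0 : ℝ)).smul_const (Hᵀ * X + Xᵀ * H)).const_add (Xᵀ * X)).fun_add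
    ((hasDerivAt_pow 2 (0 : ℝ)).smul_const (Hᵀ * H))).congr_deriv ?_
  simp

theorem hasGateauxDerivAt_trace_gram_pow (X : Matrix (Fin m) (Fin n) ℝ) (k : ℕ) :
    HasGateauxDerivAt (fun Y => ((Yᵀ * Y) ^ k).trace)
      ((2 * k : ℝ) • (X * (Xᵀ * X) ^ (k - 1))) X := by
  intro H
  refine (hasDerivAt_trace_pow (hasDerivAt_gram_line X H) k).congr_deriv ?_
  simp only [zero_smul, add_zero]
  set P := (Xᵀ * X) ^ (k - 1) with P_def
  have hP : Pᵀ = P := by simp [P_def, Matrix.transpose_pow]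
  have trace_symm : (P * (Hᵀ * X)).trace = (P * (Xᵀ * H)).trace := by
    rw [← Matrix.trace_transpose, Matrix.transpose_mul, Matrix.transpose_mul, hP,
      Matrix.transpose_transpose, Matrix.trace_mul_comm]
  rw [Matrix.mul_add, Matrix.trace_add, trace_symm, Matrix.transpose_smul, Matrix.smul_mul,
    Matrix.trace_smul, Matrix.transpose_mul, hP, Matrix.mul_assoc, smul_eq_mul]
  ring

end PowerTraces

/-- `HasSpectralGradient f g` says that the spectral function `X ↦ ∑ f(σ_i(X))` is Gateaux
differentiable on matrices of every size, with derivative `Uᵀ Diag(g(σ_1), …, g(σ_m)) V` at `X`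
for every singular value decomposition `X = Uᵀ Σ V`. The function `g` plays the role of `f'`. -/
def HasSpectralGradient (f g : ℝ → ℝ) : Prop :=
  ∀ ⦃m n : ℕ⦄ (X : Matrix (Fin m) (Fin n) ℝ) (U : Matrix (Fin m) (Fin m) ℝ)
    (V : Matrix (Fin n) (Fin n) ℝ), IsSVD X U V →
      HasGateauxDerivAt (PhiHat f) (U.transpose * rectDiag m n (fun i => g (sigma X i)) * V) X

theorem rectDiag_add {m n : ℕ} (d e : ℕ → ℝ) :
    rectDiag m n (fun i => d i + e i) = rectDiag m n d + rectDiag m n e := by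
  ext i j
  by_cases hij : (i : ℕ) = j <;> simp [rectDiag, hij]

theorem rectDiag_const_mul {m n : ℕ} (c : ℝ) (d : ℕ → ℝ) :
    rectDiag m n (fun i => c * d i) = c • rectDiag m n d := by
  ext i j
  by_cases hij : (i : ℕ) = j <;> simp [rectDiag, hij]

namespace HasSpectralGradient

variable {f f₁ f₂ g g₁ g₂ : ℝ → ℝ}

theorem const (c : ℝ) : HasSpectralGradient (fun _ => c) fun _ => 0 := by
  intro m n X U V _
  have zero_eq : rectDiag m n (fun _ => 0) = 0 := by simpa using rectDiag_const_mul 0 0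
  rw [zero_eq, Matrix.mul_zero, Matrix.zero_mul]
  exact HasGateauxDerivAt.const _ X

theorem add (h₁ : HasSpectralGradient f₁ g₁) (h₂ : HasSpectralGradient f₂ g₂) :
    HasSpectralGradient (fun t => f₁ t + f₂ t) fun t => g₁ t + g₂ t := by
  intro m n X U V h
  have PhiHat_add : PhiHat (fun t => f₁ t + f₂ t) =
      fun Y : Matrix (Fin m) (Fin n) ℝ => PhiHat f₁ Y + PhiHat f₂ Y :=
    funext fun Y => Finset.sum_add_distrib
  rw [PhiHat_add, rectDiag_add, Matrix.mul_add, Matrix.add_mul]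
  exact (h₁ X U V h).add (h₂ X U V h)

theorem const_mul (c : ℝ) (hf : HasSpectralGradient f g) :
    HasSpectralGradient (fun t => c * f t) fun t => c * g t := by
  intro m n X U V h
  have PhiHat_const_mul : PhiHat (fun t => c * f t) =
      fun Y : Matrix (Fin m) (Fin n) ℝ => c * PhiHat f Y :=
    funext fun Y => (Finset.mul_sum _ _ _).symm
  rw [PhiHat_const_mul, rectDiag_const_mul, Matrix.mul_smul, Matrix.smul_mul]
  exact (hf X U V h).const_mul c

theorem even_pow {k : ℕ} (hk : k ≠ 0) :
    HasSpectralGradient (fun t => t ^ (2 * k)) fun t => 2 * k * t ^ (2 * k - 1) := by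
  intro m n X U V h
  have exponent_eq : 2 * k - 1 = 2 * (k - 1) + 1 := by omega
  have PhiHat_eq_trace : PhiHat (fun t => t ^ (2 * k)) =
      fun Y : Matrix (Fin m) (Fin n) ℝ => ((Y.transpose * Y) ^ k).trace :=
    funext fun Y => PhiHat_even_pow Y hk
  rw [PhiHat_eq_trace, rectDiag_const_mul, Matrix.mul_smul, Matrix.smul_mul, exponent_eq,
    ← h.mul_gram_pow]
  exact hasGateauxDerivAt_trace_gram_pow X k

theorem symmetrized_polynomial (p : Polynomial ℝ) :
    HasSpectralGradient (fun t => p.eval t + p.eval (-t))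
      fun t => p.derivative.eval t - p.derivative.eval (-t) := by
  induction p using Polynomial.induction_on' with
  | add p q hp hq =>
    convert hp.add hq using 2 <;>
      simp only [Polynomial.derivative_add, Polynomial.eval_add] <;> ring
  | monomial k a =>
    simp only [Polynomial.derivative_monomial, Polynomial.eval_monomial]
    rcases k.even_or_odd with h_even | h_odd
    · obtain ⟨l, rfl⟩ := h_even.two_dvd
      rcases eq_or_ne l 0 with rfl | hl
      · simpa using const (a + a)
      · have h_odd : Odd (2 * l - 1) := ⟨l - 1, by omega⟩
        convert (even_pow hl).const_mul (2 * a) using 2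
        · rw [h_even.neg_pow]; ring
        · rw [h_odd.neg_pow]; push_cast; ring
    · have h_even : Even (k - 1) := by grind
      simpa [h_odd.neg_pow, h_even.neg_pow] using const 0

end HasSpectralGradient

theorem rectDiag_sub {m n : ℕ} (d e : ℕ → ℝ) :
    rectDiag m n (fun i => d i - e i) = rectDiag m n d - rectDiag m n e := by
  ext i j
  by_cases hij : (i : ℕ) = j <;> simp [rectDiag, hij]

section UniformBounds

variable {m n : ℕ}

theorem trace_transpose_mul_eq_sum {R ι κ : Type*} [Fintype ι] [Fintype κ]
    [NonUnitalNonAssocSemiring R] (A B : Matrix ι κ R) :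
    (A.transpose * B).trace = ∑ i, ∑ j, A i j * B i j := by
  rw [Finset.sum_comm]
  rfl

open scoped Matrix in
theorem norm_unitary_conj_apply_le {𝕜 ι κ : Type*} [RCLike 𝕜] [Fintype ι] [DecidableEq ι]
    [Fintype κ] [DecidableEq κ] {U : Matrix ι ι 𝕜} {V : Matrix κ κ 𝕜}
    (hU : U ∈ Matrix.unitaryGroup ι 𝕜) (hV : V ∈ Matrix.unitaryGroup κ 𝕜) (H : Matrix ι κ 𝕜)
    (i : ι) (j : κ) : ‖(U * H * Vᴴ) i j‖ ≤ ∑ l, ∑ k, ‖H k l‖ := by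
  have U_entry (k : ι) : ‖U i k‖ ≤ 1 := entry_norm_bound_of_unitary hU i k
  have V_entry (l : κ) : ‖star (V j l)‖ ≤ 1 := by
    simpa using entry_norm_bound_of_unitary hV j l
  simp only [Matrix.mul_apply, Matrix.conjTranspose_apply, Finset.sum_mul]
  calc ‖∑ l, ∑ k, U i k * H k l * star (V j l)‖
      ≤ ∑ l, ∑ k, ‖U i k * H k l * star (V j l)‖ :=
        (norm_sum_le _ _).trans (Finset.sum_le_sum fun l _ => norm_sum_le _ _)
    _ ≤ ∑ l, ∑ k, ‖H k l‖ := by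
        refine Finset.sum_le_sum fun l _ => Finset.sum_le_sum fun k _ => ?_
        rw [norm_mul, norm_mul]
        exact (mul_le_of_le_one_right (by positivity) (V_entry l)).trans
          (mul_le_of_le_one_left (norm_nonneg _) (U_entry k))

theorem abs_trace_transpose_mul_rectDiag_le {U : Matrix (Fin m) (Fin m) ℝ}
    {V : Matrix (Fin n) (Fin n) ℝ} (hU : U ∈ Matrix.orthogonalGroup (Fin m) ℝ)
    (hV : V ∈ Matrix.orthogonalGroup (Fin n) ℝ) (H : Matrix (Fin m) (Fin n) ℝ) {d : ℕ → ℝ} {ε : ℝ}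
    (hd : ∀ i, |d i| ≤ ε) :
    |((U.transpose * rectDiag m n d * V).transpose * H).trace| ≤
      m * n * (∑ l, ∑ k, |H k l|) * ε := by
  have trace_eq : ((U.transpose * rectDiag m n d * V).transpose * H).trace =
      ((rectDiag m n d).transpose * (U * H * V.transpose)).trace := by
    rw [Matrix.transpose_mul, Matrix.transpose_mul, Matrix.transpose_transpose, Matrix.mul_assoc,
      Matrix.trace_mul_comm]
    simp only [Matrix.mul_assoc]
  have diag_entry (i : Fin m) (j : Fin n) : |rectDiag m n d i j| ≤ ε := by
    by_cases hij : (i : ℕ) = j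
    · simpa [rectDiag, hij] using hd j
    · simpa [rectDiag, hij] using (abs_nonneg _).trans (hd 0)
  have conj_entry (i : Fin m) (j : Fin n) :
      |(U * H * V.transpose) i j| ≤ ∑ l, ∑ k, |H k l| := by
    simpa using norm_unitary_conj_apply_le hU hV H i j
  rw [trace_eq, trace_transpose_mul_eq_sum]
  calc |∑ i, ∑ j, rectDiag m n d i j * (U * H * V.transpose) i j|
      ≤ ∑ i, ∑ j, |rectDiag m n d i j * (U * H * V.transpose) i j| :=
        (Finset.abs_sum_le_sum_abs _ _).trans
          (Finset.sum_le_sum fun i _ => Finset.abs_sum_le_sum_abs _ _)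
    _ ≤ ∑ _i : Fin m, ∑ _j : Fin n, (∑ l, ∑ k, |H k l|) * ε := by
        refine Finset.sum_le_sum fun i _ => Finset.sum_le_sum fun j _ => ?_
        rw [abs_mul, mul_comm]
        exact mul_le_mul (conj_entry i j) (diag_entry i j) (abs_nonneg _) (by positivity)
    _ = m * n * (∑ l, ∑ k, |H k l|) * ε := by
        simp only [Finset.sum_const, Finset.card_univ, Fintype.card_fin, nsmul_eq_mul, mul_assoc]

theorem tendstoUniformlyOn_trace_transpose_mul_rectDiag {T ι : Type*} {l : Filter ι}
    {U : T → Matrix (Fin m) (Fin m) ℝ} {V : T → Matrix (Fin n) (Fin n) ℝ}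
    (hU : ∀ t, U t ∈ Matrix.orthogonalGroup (Fin m) ℝ)
    (hV : ∀ t, V t ∈ Matrix.orthogonalGroup (Fin n) ℝ) (H : Matrix (Fin m) (Fin n) ℝ)
    {s : Set T} {K : Set ℝ} {a : T → ℕ → ℝ} (ha : ∀ t ∈ s, ∀ i, a t i ∈ K)
    {G : ι → ℝ → ℝ} {g : ℝ → ℝ} (hG : TendstoUniformlyOn G g l K) :
    TendstoUniformlyOn
      (fun k t => (((U t).transpose * rectDiag m n (fun i => G k (a t i)) *
        V t).transpose * H).trace)
      (fun t => (((U t).transpose * rectDiag m n (fun i => g (a t i)) *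
        V t).transpose * H).trace) l s := by
  set C : ℝ := m * n * ∑ l, ∑ k, |H k l|
  have hC : 0 ≤ C := by positivity
  rw [Metric.tendstoUniformlyOn_iff]
  intro ε hε
  filter_upwards [Metric.tendstoUniformlyOn_iff.mp hG (ε / (C + 1)) (by positivity)] with k hk t ht
  have diag_le (i : ℕ) : |g (a t i) - G k (a t i)| ≤ ε / (C + 1) := (hk _ (ha t ht i)).le
  rw [Real.dist_eq, ← Matrix.trace_sub, ← Matrix.sub_mul, ← Matrix.transpose_sub,
    ← Matrix.sub_mul, ← Matrix.mul_sub, ← rectDiag_sub]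
  calc _ ≤ C * (ε / (C + 1)) := abs_trace_transpose_mul_rectDiag_le (hU t) (hV t) H diag_le
    _ < (C + 1) * (ε / (C + 1)) := by gcongr; exact lt_add_one C
    _ = ε := by field_simp

theorem exists_sigma_add_smul_mem_Icc (X H : Matrix (Fin m) (Fin n) ℝ) :
    ∃ R : ℝ, ∀ t ∈ Set.Icc (-1 : ℝ) 1, ∀ i, sigma (X + t • H) i ∈ Set.Icc 0 R := by
  have h_cont : Continuous fun t : ℝ => ((X + t • H).transpose * (X + t • H)).trace := by fun_prop
  obtain ⟨C, hC⟩ := isCompact_Icc.exists_bound_of_continuousOn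
    (h_cont.continuousOn (s := Set.Icc (-1) 1))
  refine ⟨√C, fun t ht i => ⟨LinearMap.singularValues_nonneg _ i, Real.le_sqrt_of_sq_le ?_⟩⟩
  exact (sigma_sq_le_trace_gram _ i).trans ((le_abs_self _).trans (hC t ht))

end UniformBounds

theorem IsSVD.exists_extension {m n : ℕ} {X : Matrix (Fin m) (Fin n) ℝ}
    {U : Matrix (Fin m) (Fin m) ℝ} {V : Matrix (Fin n) (Fin n) ℝ} (h : IsSVD X U V) :
    ∃ (L : Matrix (Fin m) (Fin n) ℝ → Matrix (Fin m) (Fin m) ℝ)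
      (R : Matrix (Fin m) (Fin n) ℝ → Matrix (Fin n) (Fin n) ℝ),
      (∀ Y, IsSVD Y (L Y) (R Y)) ∧ L X = U ∧ R X = V := by
  have svd_at (Y) : ∃ U' V', IsSVD Y U' V' ∧ (Y = X → U' = U ∧ V' = V) := by
    by_cases hY : Y = X
    · exact ⟨U, V, hY ▸ h, fun _ => ⟨rfl, rfl⟩⟩
    · obtain ⟨U', V', h'⟩ := exists_isSVD Y
      exact ⟨U', V', h', fun h_eq => absurd h_eq hY⟩
  choose L R hLR hX using svd_at
  exact ⟨L, R, hLR, hX X rfl⟩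

open Filter Topology in
theorem HasSpectralGradient.of_tendsto {ι : Type*} {l : Filter ι} [l.NeBot] {F G : ι → ℝ → ℝ}
    {f g : ℝ → ℝ} (hFG : ∀ k, HasSpectralGradient (F k) (G k))
    (hF : ∀ t, 0 ≤ t → Tendsto (fun k => F k t) l (𝓝 (f t)))
    (hG : ∀ R, TendstoUniformlyOn G g l (Set.Icc 0 R)) : HasSpectralGradient f g := by
  intro m n X U V h H
  obtain ⟨L, R, hLR, rfl, rfl⟩ := h.exists_extension
  obtain ⟨M, hM⟩ := exists_sigma_add_smul_mem_Icc X H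
  let Y (t : ℝ) : Matrix (Fin m) (Fin n) ℝ := X + t • H
  let D (g : ℝ → ℝ) (t : ℝ) : ℝ :=
    (((L (Y t)).transpose * rectDiag m n (fun i => g (sigma (Y t) i)) *
      R (Y t)).transpose * H).trace
  have hY {t : ℝ} (ht : t ∈ Set.Ioo (-1 : ℝ) 1) (i : ℕ) : sigma (Y t) i ∈ Set.Icc 0 M :=
    hM t (Set.Ioo_subset_Icc_self ht) i
  have D_tendsto : TendstoUniformlyOn (fun k => D (G k)) (D g) l (Set.Ioo (-1) 1) :=
    tendstoUniformlyOn_trace_transpose_mul_rectDiag (fun t => (hLR (Y t)).left_orthogonal)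
      (fun t => (hLR (Y t)).right_orthogonal) H (fun t ht => hY ht) (hG M)
  have F_hasDerivAt (k : ι) (t : ℝ) : HasDerivAt (fun s => PhiHat (F k) (Y s)) (D (G k) t) t :=
    (hFG k (Y t) _ _ (hLR (Y t))).hasDerivAt_line
  have F_tendsto (t : ℝ) (ht : t ∈ Set.Ioo (-1 : ℝ) 1) :
      Tendsto (fun k => PhiHat (F k) (Y t)) l (𝓝 (PhiHat f (Y t))) :=
    tendsto_finsetSum _ fun i _ => hF _ (hY ht i).1
  have h_deriv := hasDerivAt_of_tendstoUniformlyOn isOpen_Ioo D_tendsto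
    (.of_forall fun k t _ => F_hasDerivAt k t) F_tendsto (x := 0) (by norm_num)
  simpa [D, Y] using! h_deriv

section EvenFunctions

open Filter Topology Polynomial

theorem exists_polynomial_derivative_eq {K : Type*} [Field K] [CharZero K] (p : K[X]) (c : K) :
    ∃ P : K[X], derivative P = p ∧ P.eval 0 = c := by
  obtain ⟨Q, hQ⟩ : ∃ Q : K[X], derivative Q = p := by
    induction p using Polynomial.induction_on' with
    | add p q hp hq =>
      obtain ⟨P, rfl⟩ := hp
      obtain ⟨Q, rfl⟩ := hq
      exact ⟨P + Q, derivative_add⟩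
    | monomial k a =>
      have hk : (k + 1 : K) ≠ 0 := k.cast_add_one_ne_zero
      exact ⟨monomial (k + 1) (a / (k + 1)), by simp [hk]⟩
  exact ⟨Q + C (c - Q.eval 0), by simp [hQ], by simp⟩

theorem odd_deriv_of_even {𝕜 E : Type*} [NontriviallyNormedField 𝕜] [NormedAddCommGroup E]
    [NormedSpace 𝕜 E] {f : 𝕜 → E} (hf : Function.Even f) : Function.Odd (deriv f) := by
  intro t
  have h_comp : (fun s => f (-s)) = f := funext hf
  have h_deriv := deriv_comp_neg f t
  rw [h_comp] at h_deriv
  rw [h_deriv, neg_neg]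

theorem exists_symmetrized_polynomial_near {f : ℝ → ℝ} (hf : ContDiff ℝ 1 f)
    (hf_even : Function.Even f) {R ε : ℝ} (hR : 0 ≤ R) (hε : 0 < ε) :
    ∃ P : ℝ[X], ∀ t ∈ Set.Icc 0 R, |P.eval t + P.eval (-t) - f t| ≤ ε * t ∧
      |P.derivative.eval t - P.derivative.eval (-t) - deriv f t| ≤ ε := by
  obtain ⟨hf_diff, hf_cont⟩ := contDiff_one_iff_deriv.mp hf
  obtain ⟨p, hp⟩ := exists_polynomial_near_of_continuousOn (-R) R (fun t => deriv f t / 2)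
    (hf_cont.div_const 2).continuousOn (ε / 2) (by positivity)
  obtain ⟨P, rfl, hP⟩ := exists_polynomial_derivative_eq p (f 0 / 2)
  have deriv_near {t : ℝ} (ht : t ∈ Set.Icc 0 R) :
      |P.derivative.eval t - P.derivative.eval (-t) - deriv f t| ≤ ε := by
    have near_pos := abs_lt.mp (hp t ⟨by linarith [ht.1], ht.2⟩)
    have near_neg := abs_lt.mp (hp (-t) ⟨by linarith [ht.2], by linarith [ht.1]⟩)
    rw [odd_deriv_of_even hf_even t] at near_neg
    rw [abs_le]
    constructor <;> linarith
  have h_deriv (t : ℝ) : HasDerivAt (fun s => P.eval s + P.eval (-s) - f s)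
      (P.derivative.eval t - P.derivative.eval (-t) - deriv f t) t :=
    (((P.hasDerivAt t).fun_add ((P.hasDerivAt (-t)).comp t (hasDerivAt_neg t))).fun_sub
      (hf_diff t).hasDerivAt).congr_deriv (by ring)
  refine ⟨P, fun t ht => ⟨?_, deriv_near ht⟩⟩
  have mean_value := (convex_Icc 0 R).norm_image_sub_le_of_norm_hasDerivWithin_le
    (fun s _ => (h_deriv s).hasDerivWithinAt) (fun s hs => deriv_near hs)
    (Set.left_mem_Icc.mpr hR) ht
  simpa [hP, abs_of_nonneg ht.1] using mean_value

theorem hasSpectralGradient_deriv_of_even {f : ℝ → ℝ} (hf : ContDiff ℝ 1 f)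
    (hf_even : Function.Even f) : HasSpectralGradient f (deriv f) := by
  have poly_near (k : ℕ) := exists_symmetrized_polynomial_near hf hf_even
    (Nat.cast_nonneg (α := ℝ) k) (Nat.one_div_pos_of_nat (n := k))
  choose P hP using poly_near
  have eventually_Icc_subset (R : ℝ) : ∀ᶠ k : ℕ in atTop, Set.Icc 0 R ⊆ Set.Icc (0 : ℝ) k :=
    (tendsto_natCast_atTop_atTop.eventually_ge_atTop R).mono fun k hk =>
      Set.Icc_subset_Icc_right hk
  refine .of_tendsto (l := atTop) (fun k => .symmetrized_polynomial (P k)) (fun t ht => ?_)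
    fun R => ?_
  · rw [tendsto_iff_norm_sub_tendsto_zero]
    have bound_tendsto : Tendsto (fun k : ℕ => 1 / ((k : ℝ) + 1) * t) atTop (𝓝 0) := by
      simpa using (tendsto_one_div_add_atTop_nhds_zero_nat (𝕜 := ℝ)).mul_const t
    refine squeeze_zero' (.of_forall fun k => norm_nonneg _) ?_ bound_tendsto
    filter_upwards [eventually_Icc_subset t] with k hk
    exact (hP k t (hk ⟨ht, le_rfl⟩)).1
  · rw [Metric.tendstoUniformlyOn_iff]
    intro ε hε
    filter_upwards [eventually_Icc_subset R,
      (tendsto_one_div_add_atTop_nhds_zero_nat (𝕜 := ℝ)).eventually_lt_const hε]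
      with k hk hkε t ht
    rw [dist_comm]
    exact (hP k t (hk ht)).2.trans_lt hkε

end EvenFunctions

section CompAbs

open Filter Topology

variable {F F' F'' : ℝ → ℝ} {t d : ℝ}

theorem isLittleO_comp_abs_sub_linear (hF : HasDerivAt F d 0) :
    (fun s => F |s| - F 0 - |s| * d) =o[𝓝 0] fun s => s := by
  have abs_tendsto : Tendsto (fun s : ℝ => |s|) (𝓝 0) (𝓝 0) := by
    simpa using continuous_abs.tendsto (0 : ℝ)
  have h_little := (hasDerivAt_iff_isLittleO_nhds_zero.mp hF).comp_tendsto abs_tendsto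
  simpa only [Function.comp_def, zero_add, smul_eq_mul] using
    Asymptotics.isLittleO_abs_right.mp h_little

theorem hasDerivAt_comp_abs (hF : HasDerivAt F d |t|) (h_zero : t = 0 → d = 0) :
    HasDerivAt (fun s => F |s|) (SignType.sign t * d) t := by
  rcases eq_or_ne t 0 with rfl | ht
  · obtain rfl := h_zero rfl
    rw [abs_zero] at hF
    simpa [hasDerivAt_iff_isLittleO_nhds_zero] using isLittleO_comp_abs_sub_linear hF
  · exact (hF.comp t (hasDerivAt_abs ht)).congr_deriv (mul_comm _ _)

theorem hasDerivAt_sign_mul_comp_abs (hF : HasDerivAt F d |t|) (h_zero : F 0 = 0) :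
    HasDerivAt (fun s => SignType.sign s * F |s|) d t := by
  rcases lt_trichotomy t 0 with ht | rfl | ht
  · have eq_neg : (fun s => SignType.sign s * F |s|) =ᶠ[𝓝 t] fun s => -F (-s) := by
      filter_upwards [Iio_mem_nhds ht] with s (hs : s < 0)
      simp [sign_neg hs, abs_of_neg hs]
    rw [abs_of_neg ht] at hF
    exact ((hF.comp t (hasDerivAt_neg t)).neg.congr_deriv (by simp)).congr_of_eventuallyEq eq_neg
  · rw [abs_zero] at hF
    have sign_isBigO : (fun s : ℝ => (SignType.sign s : ℝ)) =O[𝓝 0] fun _ => (1 : ℝ) :=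
      .of_bound 1 (.of_forall fun s => by cases h : SignType.sign s <;> simp)
    have h_little := sign_isBigO.mul_isLittleO (isLittleO_comp_abs_sub_linear hF)
    simpa [hasDerivAt_iff_isLittleO_nhds_zero, h_zero, mul_sub, ← mul_assoc] using h_little
  · have eq_self : (fun s => SignType.sign s * F |s|) =ᶠ[𝓝 t] F := by
      filter_upwards [Ioi_mem_nhds ht] with s (hs : 0 < s)
      simp [sign_pos hs, abs_of_pos hs]
    rw [abs_of_pos ht] at hF
    exact hF.congr_of_eventuallyEq eq_self

theorem contDiff_two_comp_abs (hF : ∀ t, 0 ≤ t → HasDerivAt F (F' t) t)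
    (hF' : ∀ t, 0 ≤ t → HasDerivAt F' (F'' t) t) (h_zero : F' 0 = 0)
    (hF'' : ContinuousOn F'' (Set.Ici 0)) : ContDiff ℝ 2 fun t => F |t| := by
  have deriv_one (t : ℝ) : HasDerivAt (fun s => F |s|) (SignType.sign t * F' |t|) t :=
    hasDerivAt_comp_abs (hF _ (abs_nonneg t)) fun ht => by simp [ht, h_zero]
  have deriv_two (t : ℝ) : HasDerivAt (fun s => SignType.sign s * F' |s|) (F'' |t|) t :=
    hasDerivAt_sign_mul_comp_abs (hF' _ (abs_nonneg t)) h_zero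
  rw [← one_add_one_eq_two, contDiff_succ_iff_deriv, contDiff_one_iff_deriv,
    funext fun t => (deriv_one t).deriv, funext fun t => (deriv_two t).deriv]
  exact ⟨fun t => (deriv_one t).differentiableAt, by simp,
    fun t => (deriv_two t).differentiableAt, hF''.comp_continuous continuous_abs abs_nonneg⟩

end CompAbs

theorem psi_even {φ : ℝ → ℝ} (hφ : Function.Even φ) (α : ℝ) : Function.Even (psi φ α) :=
  fun t => by simp only [psi, hφ t, abs_neg]

theorem fracPenalty_even (α : ℝ) : Function.Even (fracPenalty α) :=
  fun t => by simp only [fracPenalty, abs_neg]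

theorem contDiff_two_psi_fracPenalty {α : ℝ} (hα : 0 ≤ α) :
    ContDiff ℝ 2 (psi (fracPenalty α) α) := by
  have denom_ne {t : ℝ} (ht : 0 ≤ t) : 1 + α * t ≠ 0 := by positivity
  have h_linear (t : ℝ) : HasDerivAt (fun s => α * s) α t := by
    simpa using (hasDerivAt_id t).const_mul α
  refine contDiff_two_comp_abs (F := fun t => α * t / (1 + α * t) - α * t)
    (F' := fun t => α / (1 + α * t) ^ 2 - α) (F'' := fun t => -(2 * α ^ 2) / (1 + α * t) ^ 3)
    (fun t ht => ?_) (fun t ht => ?_) (by simp) ?_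
  · refine (((h_linear t).div ((h_linear t).const_add 1) (denom_ne ht)).sub
      (h_linear t)).congr_deriv ?_
    ring
  · refine (((hasDerivAt_const t α).div (((h_linear t).const_add 1).fun_pow 2)
      (pow_ne_zero 2 (denom_ne ht))).sub_const α).congr_deriv ?_
    have := denom_ne ht
    field_simp
    ring
  · exact ContinuousOn.div (by fun_prop) (by fun_prop) fun t ht => pow_ne_zero 3 (denom_ne ht)

theorem exists_hasGateauxDerivAt_PsiHat {φ : ℝ → ℝ} {α : ℝ} (hφ : Function.Even φ)
    (hψ : ContDiff ℝ 1 (psi φ α)) {m n : ℕ} (X : Matrix (Fin m) (Fin n) ℝ) :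
    ∃ G : Matrix (Fin m) (Fin n) ℝ, HasGateauxDerivAt (PsiHat φ α) G X ∧
      ∀ (U : Matrix (Fin m) (Fin m) ℝ) (V : Matrix (Fin n) (Fin n) ℝ), IsSVD X U V →
        G = U.transpose * rectDiag m n (fun i => deriv (psi φ α) (sigma X i)) * V := by
  have h_gradient := hasSpectralGradient_deriv_of_even hψ (psi_even hφ α)
  obtain ⟨U, V, h⟩ := exists_isSVD X
  exact ⟨_, h_gradient X U V h, fun U' V' h' => (h_gradient X U V h).unique (h_gradient X U' V' h')⟩

theorem mainTheorem9 :
    (∀ (φ : ℝ → ℝ) (α : ℝ), Function.Even φ → ContDiff ℝ 1 (psi φ α) →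
      ∀ (m n : ℕ) (X : Matrix (Fin m) (Fin n) ℝ),
        ∃ G : Matrix (Fin m) (Fin n) ℝ, HasGateauxDerivAt (PsiHat φ α) G X ∧
          ∀ (U : Matrix (Fin m) (Fin m) ℝ) (V : Matrix (Fin n) (Fin n) ℝ), IsSVD X U V →
            G = U.transpose * rectDiag m n (fun i => deriv (psi φ α) (sigma X i)) * V) ∧
    (∀ α : ℝ, 0 < α →
      ContDiff ℝ 2 (psi (fracPenalty α) α) ∧
      ∀ (m n : ℕ) (X : Matrix (Fin m) (Fin n) ℝ),
        ∃ G : Matrix (Fin m) (Fin n) ℝ, HasGateauxDerivAt (PsiHat (fracPenalty α) α) G X ∧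
          ∀ (U : Matrix (Fin m) (Fin m) ℝ) (V : Matrix (Fin n) (Fin n) ℝ), IsSVD X U V →
            G = U.transpose *
              rectDiag m n (fun i => deriv (psi (fracPenalty α) α) (sigma X i)) * V) := by
  refine ⟨fun φ α hφ hψ m n X => exists_hasGateauxDerivAt_PsiHat hφ hψ X, fun α hα => ?_⟩
  have hψ : ContDiff ℝ 2 (psi (fracPenalty α) α) := contDiff_two_psi_fracPenalty hα.le
  exact ⟨hψ, fun m n X => exists_hasGateauxDerivAt_PsiHat (fracPenalty_even α)
    (hψ.of_le one_le_two) X⟩
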